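/- Let $n\ge 2$, and let $C=D^{-1}JD$, where $J$ is the $n\times n$ nilpotent shift with ones on the subdiagonal and zeros elsewhere, and $D=\operatorname{diag}(\sqrt2,1,\dots,1,1/\sqrt2)$. Thus all entries of $C$ off the subdiagonal are $0$, and the subdiagonal entries are, from top to bottom, $\sqrt2,1,\dots,1,\sqrt2$ if $n\ge 3$ (with $n-3$ ones), while for $n=2$ the single subdiagonal entry is $2$. Let $\mathbb{D}$ be the open unit disk in $\mathbb{C}$, and let $W(C)=\{\langle Cx,x\rangle : x\in\mathbb{C}^n,\ \|x\|=1\}$ be the numerical range of $C$. A function $f$ is called extremal for $(C,\mathbb{D})$ if it is holomorphic on $\mathbb{D}$ with $|f|\le 1$ there, and $\|g(C)\|\le\|f(C)\|$ for every holomorphic $g$ on $\mathbb{D}$ with $|g|\le 1$; here $f(C)$ is given by the holomorphic functional calculus, and $\|\cdot\|$ is the Euclidean operator norm. Then $\sigma(C)=\{0\}$ and $W(C)=\overline{\mathbb{D}}$, and the extremal functions for $(C,\mathbb{D})$ are exactly the functions $f(z)=\gamma z^{n-1}$ with $\gamma\in\mathbb{C}$, $|\gamma|=1$. -/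

import Mathlib

open scoped Matrix.Norms.L2Operator

/-- The numerical range `{⟨A x, x⟩ : ‖x‖ = 1}` of a complex square matrix, for the Euclidean inner
product. As Mathlib's inner product is linear in its second slot, `⟨A x, x⟩` is `inner ℂ x (A x)`. -/
def numericalRange {n : ℕ} (A : Matrix (Fin n) (Fin n) ℂ) : Set ℂ :=
  {z | ∃ x : EuclideanSpace ℂ (Fin n), ‖x‖ = 1 ∧ inner ℂ x (Matrix.toEuclideanLin A x) = z}

/-- The polynomial `p` agrees with `f` on the spectrum of `A`: at each eigenvalue `μ` of `A`,
the derivatives of `p` and `f` of every order below the multiplicity of `μ` as a root of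
the minimal polynomial of `A` are equal. -/
def AgreesOnSpectrum {n : ℕ} (A : Matrix (Fin n) (Fin n) ℂ) (f : ℂ → ℂ) (p : Polynomial ℂ) : Prop :=
  ∀ μ : ℂ, ∀ k < (minpoly ℂ A).rootMultiplicity μ,
    (Polynomial.derivative^[k] p).eval μ = iteratedDeriv k f μ

theorem exists_agreesOnSpectrum {n : ℕ} (A : Matrix (Fin n) (Fin n) ℂ) (f : ℂ → ℂ) :
    ∃ p : Polynomial ℂ, AgreesOnSpectrum A f p := by
  classical
  set m := minpoly ℂ A with hm
  let t : ℂ → Polynomial ℂ := fun μ => ∑ k ∈ Finset.range (m.rootMultiplicity μ),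
    Polynomial.C (iteratedDeriv k f μ / (k.factorial : ℂ)) *
      (Polynomial.X - Polynomial.C μ) ^ k
  have ht : ∀ μ : ℂ, ∀ k < m.rootMultiplicity μ,
      (Polynomial.derivative^[k] (t μ)).eval μ = iteratedDeriv k f μ := by
    intro μ k hk
    simp only [t, Polynomial.iterate_derivative_sum, Polynomial.eval_finsetSum,
      Polynomial.iterate_derivative_C_mul, Polynomial.iterate_derivative_X_sub_pow,
      Polynomial.eval_mul, Polynomial.eval_C, Polynomial.eval_smul, Polynomial.eval_pow,
      Polynomial.eval_sub, Polynomial.eval_X, sub_self]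
    rw [Finset.sum_eq_single k]
    · have h : (k.factorial : ℂ) ≠ 0 := by exact_mod_cast k.factorial_ne_zero
      simp [Nat.descFactorial_self]
      field_simp
    · intro j _ hjk
      rcases lt_or_gt_of_ne hjk with h | h
      · simp [Nat.descFactorial_eq_zero_iff_lt.2 h]
      · simp [Nat.sub_ne_zero_of_lt h]
    · intro h
      exact absurd (Finset.mem_range.2 hk) h
  obtain ⟨p, hp⟩ := Ideal.exists_forall_sub_mem_ideal (ι := {μ : ℂ // μ ∈ m.roots.toFinset})
    (I := fun μ => Ideal.span {(Polynomial.X - Polynomial.C μ.1) ^ m.rootMultiplicity μ.1})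
    (fun i j hij => by
      rw [Function.onFun, Ideal.isCoprime_span_singleton_iff]
      exact (Polynomial.pairwise_coprime_X_sub_C Subtype.val_injective hij).pow)
    (fun μ => t μ.1)
  refine ⟨p, fun μ k hk => ?_⟩
  have hroot : μ ∈ m.roots.toFinset := by
    rw [Multiset.mem_toFinset, ← Multiset.count_pos, Polynomial.count_roots]
    exact lt_of_le_of_lt (Nat.zero_le k) hk
  have hd := Ideal.mem_span_singleton.1 (hp ⟨μ, hroot⟩)
  have h1 : (Polynomial.X - Polynomial.C μ) ∣ Polynomial.derivative^[k] (p - t μ) := by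
    obtain ⟨q, hq⟩ := hd
    have := Polynomial.pow_sub_dvd_iterate_derivative_of_pow_dvd k (Dvd.intro q hq.symm)
    exact (dvd_pow_self _ (Nat.sub_ne_zero_of_lt hk)).trans this
  rw [Polynomial.dvd_iff_isRoot, Polynomial.IsRoot, Polynomial.iterate_derivative_sub,
    Polynomial.eval_sub, ht μ k hk, sub_eq_zero] at h1
  exact h1

/-- The matrix `f(A)`, for `f` holomorphic near the spectrum of `A`: the common value `p(A)` of the
polynomials `p` that agree with `f` on the spectrum of `A`. -/
noncomputable def matrixFun (f : ℂ → ℂ) {n : ℕ} (A : Matrix (Fin n) (Fin n) ℂ) :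
    Matrix (Fin n) (Fin n) ℂ :=
  Polynomial.aeval A (exists_agreesOnSpectrum A f).choose

/-- The value `p(A)` does not depend on the choice of `p`. -/
theorem matrixFun_eq_aeval {n : ℕ} (A : Matrix (Fin n) (Fin n) ℂ) (f : ℂ → ℂ) (p : Polynomial ℂ)
    (hp : AgreesOnSpectrum A f p) : matrixFun f A = Polynomial.aeval A p := by
  classical
  set q := (exists_agreesOnSpectrum A f).choose with hq
  have hqs : AgreesOnSpectrum A f q := (exists_agreesOnSpectrum A f).choose_spec
  have hm0 : minpoly ℂ A ≠ 0 := minpoly.ne_zero (Matrix.isIntegral A)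
  have hdvd : minpoly ℂ A ∣ q - p := by
    by_cases h0 : q - p = 0
    · rw [h0]; exact dvd_zero _
    rw [IsAlgClosed.dvd_iff_roots_le_roots hm0 h0, Multiset.le_iff_count]
    intro μ
    rw [Polynomial.count_roots, Polynomial.count_roots]
    by_contra! hlt
    have hle : (q - p).rootMultiplicity μ < (q - p).rootMultiplicity μ := by
      rw [Polynomial.lt_rootMultiplicity_iff_isRoot_iterate_derivative h0]
      intro k hk
      rw [Polynomial.IsRoot, Polynomial.iterate_derivative_sub, Polynomial.eval_sub,
        hqs μ k (lt_of_le_of_lt hk hlt), hp μ k (lt_of_le_of_lt hk hlt), sub_self]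
    exact lt_irrefl _ hle
  have h := (minpoly.dvd_iff).1 hdvd
  rw [map_sub, sub_eq_zero] at h
  exact h

/-- The closed unit ball of the space of bounded holomorphic functions on `Ω`. Only the values on
`Ω` matter. -/
def hInftyUnitBall (Ω : Set ℂ) : Set (ℂ → ℂ) :=
  {f | DifferentiableOn ℂ f Ω ∧ ∀ z ∈ Ω, ‖f z‖ ≤ 1}

/-- `f` is extremal for the pair `(A, Ω)`, where `Ω` is an open set containing the spectrum of `A`:
`f` lies in the closed unit ball of `H^∞(Ω)` and maximizes `‖f(A)‖` there. The norm of a matrix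
is the operator norm for the Euclidean norm. -/
def IsExtremal {n : ℕ} (A : Matrix (Fin n) (Fin n) ℂ) (Ω : Set ℂ) (f : ℂ → ℂ) : Prop :=
  f ∈ hInftyUnitBall Ω ∧ ∀ g ∈ hInftyUnitBall Ω, ‖matrixFun g A‖ ≤ ‖matrixFun f A‖

/-- The `n × n` matrix `C = D⁻¹ J D`, with `J` the nilpotent shift with ones on the subdiagonal and
`D = diag(√2, 1, …, 1, 1/√2)`. Its only nonzero entries are on the subdiagonal: they are
`√2, 1, …, 1, √2` if `3 ≤ n`, and the single entry is `2` if `n = 2`. -/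
noncomputable def crabbMatrix (n : ℕ) : Matrix (Fin n) (Fin n) ℂ :=
  Matrix.of fun i j =>
    if (i : ℕ) = j + 1 then
      (if (j : ℕ) = 0 then ((√2 : ℝ) : ℂ) else 1) * (if (i : ℕ) + 1 = n then ((√2 : ℝ) : ℂ) else 1)
    else 0

/-! Since `C = D⁻¹JD`, `f(C) = D⁻¹TD` with `T` the lower triangular Toeplitz matrix of the Taylor
coefficients `a_k` of `f`. `T` is a truncation of multiplication by `f` on `H²`, hence a contraction
(`sum_sq_norm_toeplitz_le`). As `‖D‖² = ‖D⁻¹‖² = 2`, this gives `‖f(C)‖ ≤ 2`; the corner entry of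
`f(C)` is `2 a_{n-1}`, so `γ z^{n-1}` attains the bound.

Conversely, `D` stretches by `√2` only along the first basis vector and `D⁻¹` only along the last.
If the norm is 2, a maximizing `x` is thus a multiple of the first basis vector, and `TDx` is a
multiple of the last. Hence `a_k = 0` for `k < n-1` and `|a_{n-1}| = 1`; Bessel's inequality `∑
|a_k|² ≤ 1` kills all later coefficients.

The numerical range is computed by AM-GM with the weights split between neighbouring coordinates,
and an explicit family of vectors fills the disk. The spectrum is `{0}` because `C` is nilpotent. -/

/-! ### Multiplication by bounded functions on `H²` -/

open Polynomial in
-- By Parseval, both full coefficient sums are averages of squared moduli over the unit circle,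
-- where `|qp| ≤ M|p|`.
theorem Polynomial.sum_sq_norm_coeff_mul_le (p q : ℂ[X]) (M : ℝ)
    (hq : ∀ z : ℂ, ‖z‖ = 1 → ‖q.eval z‖ ≤ M) (N : ℕ) :
    ∑ k ∈ Finset.range N, ‖(q * p).coeff k‖ ^ 2 ≤ M ^ 2 * ∑ k ∈ p.support, ‖p.coeff k‖ ^ 2 := by
  have h1 : ∑ k ∈ Finset.range N, ‖(q * p).coeff k‖ ^ 2 ≤
      ∑ k ∈ (q * p).support, ‖(q * p).coeff k‖ ^ 2 := by
    rw [← Finset.sum_filter_add_sum_filter_not (Finset.range N) (· ∈ (q * p).support)]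
    rw [Finset.sum_eq_zero (s := (Finset.range N).filter (· ∉ (q * p).support)), add_zero]
    · exact Finset.sum_le_sum_of_subset_of_nonneg (fun x hx => (Finset.mem_filter.1 hx).2)
        fun _ _ _ => by positivity
    · intro k hk
      simp [notMem_support_iff.1 (Finset.mem_filter.1 hk).2]
  refine h1.trans ?_
  rw [sum_sq_norm_coeff_eq_circleAverage, sum_sq_norm_coeff_eq_circleAverage, ← smul_eq_mul (M ^ 2),
    ← Real.circleAverage_fun_smul]
  refine Real.circleAverage_mono ?_ ?_ ?_
  · exact ContinuousOn.circleIntegrable' (by fun_prop)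
  · exact ContinuousOn.circleIntegrable' (by fun_prop)
  · intro z hz
    have hz1 : ‖z‖ = 1 := by simpa using hz
    rw [eval_mul, norm_mul, mul_pow, smul_eq_mul]
    have := hq z hz1
    gcongr

/-- The `k`-th Taylor coefficient at `0`. -/
noncomputable def taylorCoeff (f : ℂ → ℂ) (k : ℕ) : ℂ := iteratedDeriv k f 0 / (k.factorial : ℂ)

theorem hasSum_taylorCoeff {f : ℂ → ℂ} (hf : DifferentiableOn ℂ f (Metric.ball 0 1)) {z : ℂ}
    (hz : z ∈ Metric.ball (0 : ℂ) 1) : HasSum (fun k => taylorCoeff f k * z ^ k) (f z) := by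
  have e : (fun k => taylorCoeff f k * z ^ k) =
      fun k : ℕ => (k.factorial : ℂ)⁻¹ • (z - 0) ^ k • iteratedDeriv k f 0 := by
    ext k
    simp only [taylorCoeff, sub_zero, smul_eq_mul]
    ring
  rw [e]
  exact Complex.hasSum_taylorSeries_on_ball hf hz

/-- On `‖z‖ = 1`, the Taylor polynomials of `z ↦ f (r z)` are eventually bounded by `1 + ε`. -/
theorem eventually_norm_taylor_partial_sum_le {f : ℂ → ℂ}
    (hf : f ∈ hInftyUnitBall (Metric.ball 0 1)) {r : ℝ}
    (hr0 : 0 ≤ r) (hr1 : r < 1) {ε : ℝ} (hε : 0 < ε) :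
    ∀ᶠ L in Filter.atTop, ∀ z : ℂ, ‖z‖ = 1 →
      ‖∑ k ∈ Finset.range L, taylorCoeff f k * r ^ k * z ^ k‖ ≤ 1 + ε := by
  have hmem : ∀ z : ℂ, ‖z‖ = 1 → (r * z : ℂ) ∈ Metric.ball (0 : ℂ) 1 := by
    intro z hz
    simpa [hz, abs_of_nonneg hr0] using hr1
  -- Absolute convergence at the single point `r` supplies the Weierstrass majorant on the whole
  -- circle.
  have hs : Summable fun k => ‖taylorCoeff f k * (r : ℂ) ^ k‖ := by
    have := (hasSum_taylorCoeff hf.1 (hmem 1 (by simp))).summable.norm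
    simpa using this
  have hu := tendstoUniformlyOn_tsum_nat (f := fun k (z : ℂ) => taylorCoeff f k * r ^ k * z ^ k) hs
    (s := Metric.sphere (0 : ℂ) 1) (fun k z hz => by
      have hz1 : ‖z‖ = 1 := by simpa using hz
      simp [hz1])
  filter_upwards [Metric.tendstoUniformlyOn_iff.1 hu ε hε] with L hL z hz
  have h1 := hL z (by simpa using hz)
  have h2 : ∑' k, taylorCoeff f k * r ^ k * z ^ k = f (r * z) := by
    rw [← (hasSum_taylorCoeff hf.1 (hmem z hz)).tsum_eq]
    exact tsum_congr fun k => by rw [mul_pow, mul_assoc]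
  rw [h2, dist_comm, dist_eq_norm] at h1
  have h3 := hf.2 _ (hmem z hz)
  calc _ = ‖(∑ k ∈ Finset.range L, taylorCoeff f k * r ^ k * z ^ k - f (r * z)) + f (r * z)‖ := by
        rw [sub_add_cancel]
    _ ≤ _ := norm_add_le _ _
    _ ≤ 1 + ε := by linarith

open Polynomial in
/-- Multiplication by a function in the unit ball of `H^∞` is a contraction on `H²`. -/
theorem sum_sq_norm_taylorCoeff_conv_le {f : ℂ → ℂ}
    (hf : f ∈ hInftyUnitBall (Metric.ball 0 1)) (p : ℂ[X]) (N : ℕ) :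
    ∑ k ∈ Finset.range N, ‖∑ x ∈ Finset.HasAntidiagonal.antidiagonal k, taylorCoeff f x.1 * p.coeff x.2‖ ^ 2 ≤
      ∑ k ∈ p.support, ‖p.coeff k‖ ^ 2 := by
  -- Replace `f` by a Taylor polynomial of `f(rz)`, long enough to keep the first `N` coefficients
  -- exact. The error allowance is `1 - r`, so that it vanishes as `r → 1`.
  have key : ∀ r : ℝ, r ∈ Set.Ioo (0 : ℝ) 1 →
      ∑ k ∈ Finset.range N,
        ‖∑ x ∈ Finset.HasAntidiagonal.antidiagonal k, taylorCoeff f x.1 * r ^ x.1 * p.coeff x.2‖ ^ 2 ≤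
      (1 + (1 - r)) ^ 2 * ∑ k ∈ p.support, ‖p.coeff k‖ ^ 2 := by
    intro r hr
    obtain ⟨L, hL, hNL⟩ := ((eventually_norm_taylor_partial_sum_le hf hr.1.le hr.2
      (sub_pos.2 hr.2)).and (Filter.eventually_ge_atTop N)).exists
    let q : ℂ[X] := ∑ k ∈ Finset.range L, C (taylorCoeff f k * r ^ k) * X ^ k
    have hq : ∀ k < L, q.coeff k = taylorCoeff f k * r ^ k := by
      intro k hk
      simp only [q, finsetSum_coeff, coeff_C_mul_X_pow]
      rw [Finset.sum_ite_eq, if_pos (Finset.mem_range.2 hk)]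
    have h := sum_sq_norm_coeff_mul_le p q (1 + (1 - r)) (fun z hz => by
      simpa [q, eval_finsetSum] using hL z hz) N
    refine le_trans (le_of_eq ?_) h
    refine Finset.sum_congr rfl fun k hk => ?_
    rw [coeff_mul]
    congr 2
    refine Finset.sum_congr rfl fun x hx => ?_
    rw [hq]
    have := Finset.HasAntidiagonal.mem_antidiagonal.1 hx
    have := Finset.mem_range.1 hk
    omega
  have hev : ∀ᶠ r : ℝ in nhdsWithin 1 (Set.Iio 1), r ∈ Set.Ioo (0 : ℝ) 1 :=
    Ioo_mem_nhdsLT one_pos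
  have hl : Filter.Tendsto (fun r : ℝ => ∑ k ∈ Finset.range N,
      ‖∑ x ∈ Finset.HasAntidiagonal.antidiagonal k, taylorCoeff f x.1 * r ^ x.1 * p.coeff x.2‖ ^ 2)
      (nhdsWithin 1 (Set.Iio 1)) (nhds (∑ k ∈ Finset.range N,
      ‖∑ x ∈ Finset.HasAntidiagonal.antidiagonal k, taylorCoeff f x.1 * (1 : ℝ) ^ x.1 * p.coeff x.2‖ ^ 2)) := by
    refine Filter.Tendsto.mono_left (Continuous.tendsto ?_ 1) nhdsWithin_le_nhds
    fun_prop
  have hr : Filter.Tendsto (fun r : ℝ => (1 + (1 - r)) ^ 2 * ∑ k ∈ p.support, ‖p.coeff k‖ ^ 2)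
      (nhdsWithin 1 (Set.Iio 1)) (nhds ((1 + (1 - 1)) ^ 2 * ∑ k ∈ p.support, ‖p.coeff k‖ ^ 2)) := by
    refine Filter.Tendsto.mono_left (Continuous.tendsto
      (f := fun r : ℝ => (1 + (1 - r)) ^ 2 * ∑ k ∈ p.support, ‖p.coeff k‖ ^ 2) ?_ 1)
      nhdsWithin_le_nhds
    fun_prop
  have := le_of_tendsto_of_tendsto hl hr (hev.mono key)
  simpa using this

/-- Bessel's inequality for the unit ball of `H^∞`. -/
theorem sum_sq_norm_taylorCoeff_le_one {f : ℂ → ℂ}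
    (hf : f ∈ hInftyUnitBall (Metric.ball 0 1)) (N : ℕ) :
    ∑ k ∈ Finset.range N, ‖taylorCoeff f k‖ ^ 2 ≤ 1 := by
  have h := sum_sq_norm_taylorCoeff_conv_le hf 1 N
  have hs : (1 : Polynomial ℂ).support = {0} := by
    rw [← Polynomial.C_1]; exact Polynomial.support_C one_ne_zero
  rw [hs] at h
  simp only [Finset.sum_singleton, Polynomial.coeff_one_zero, norm_one, one_pow] at h
  refine le_trans (le_of_eq ?_) h
  refine Finset.sum_congr rfl fun k _ => ?_
  rw [Finset.Nat.sum_antidiagonal_eq_sum_range_succ (fun i j => taylorCoeff f i *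
    (1 : Polynomial ℂ).coeff j), Finset.sum_range_succ, Finset.sum_eq_zero]
  · simp
  · intro j hj
    have := Finset.mem_range.1 hj
    rw [Polynomial.coeff_one, if_neg (by omega), mul_zero]

/-- The truncated lower triangular Toeplitz matrix of a function in the unit ball of `H^∞` is a
contraction. -/
theorem sum_sq_norm_toeplitz_le {f : ℂ → ℂ}
    (hf : f ∈ hInftyUnitBall (Metric.ball 0 1)) {n : ℕ} (y : Fin n → ℂ) :
    ∑ i : Fin n, ‖∑ j : Fin n, (if j ≤ i then taylorCoeff f (i - j : ℕ) else 0) * y j‖ ^ 2 ≤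
      ∑ j, ‖y j‖ ^ 2 := by
  classical
  let Y : ℕ → ℂ := fun k => if h : k < n then y ⟨k, h⟩ else 0
  have hY : ∀ j : Fin n, Y j = y j := fun j => by simp [Y]
  let p : Polynomial ℂ := ∑ k ∈ Finset.range n, Polynomial.C (Y k) * Polynomial.X ^ k
  have hp : ∀ k, p.coeff k = Y k := by
    intro k
    simp only [p, Polynomial.finsetSum_coeff, Polynomial.coeff_C_mul_X_pow]
    rw [Finset.sum_ite_eq]
    split_ifs with h
    · rfl
    · simp only [Finset.mem_range] at h
      simp [Y, h]
  have h := sum_sq_norm_taylorCoeff_conv_le hf p n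
  have hsupp : ∑ k ∈ p.support, ‖p.coeff k‖ ^ 2 ≤ ∑ k ∈ Finset.range n, ‖p.coeff k‖ ^ 2 := by
    refine Finset.sum_le_sum_of_subset_of_nonneg (fun k hk => ?_) fun _ _ _ => by positivity
    rw [Polynomial.mem_support_iff, hp] at hk
    by_contra hkn
    simp only [Finset.mem_range] at hkn
    exact hk (by simp [Y, hkn])
  have h2 := h.trans hsupp
  simp only [hp] at h2
  rw [Finset.sum_range, Finset.sum_range] at h2
  simp only [hY] at h2
  refine le_trans (le_of_eq ?_) h2
  refine Finset.sum_congr rfl fun i _ => ?_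
  congr 2
  rw [← Finset.Nat.sum_antidiagonal_swap]
  simp only [Prod.fst_swap, Prod.snd_swap]
  rw [Finset.Nat.sum_antidiagonal_eq_sum_range_succ (fun a b => taylorCoeff f b * Y a)]
  have e : ∑ j : Fin n, (if j ≤ i then taylorCoeff f (i - j : ℕ) else 0) * y j =
      ∑ j ∈ Finset.range n, (if j ≤ (i : ℕ) then taylorCoeff f (i - j : ℕ) else 0) * Y j := by
    rw [Finset.sum_range]
    refine Finset.sum_congr rfl fun j _ => ?_
    rw [hY]
    rfl
  rw [e]
  simp only [ite_mul, zero_mul]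
  rw [← Finset.sum_filter]
  refine Finset.sum_congr ?_ fun _ _ => rfl
  ext j
  have := i.2
  simp only [Finset.mem_filter, Finset.mem_range]
  omega


/-! ### The numerical range -/

theorem crabbMatrix_mulVec_zero (m : ℕ) (x : Fin (m + 2) → ℂ) :
    (crabbMatrix (m + 2)).mulVec x 0 = 0 := by
  simp [Matrix.mulVec, dotProduct, crabbMatrix]

/-- The weight of the Crabb matrix is the product of a factor at the first index and a factor at
the last one. -/
theorem crabbMatrix_mulVec_succ (m : ℕ) (x : Fin (m + 2) → ℂ) (j : Fin (m + 1)) :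
    (crabbMatrix (m + 2)).mulVec x j.succ =
      (((if j = 0 then √2 else 1) * (if j = Fin.last m then √2 else 1) : ℝ) : ℂ) *
        x j.castSucc := by
  rw [Matrix.mulVec, dotProduct, Finset.sum_eq_single j.castSucc]
  · simp only [crabbMatrix, Matrix.of_apply, Fin.val_succ, Fin.val_castSucc, if_true]
    have h1 : ((j : ℕ) = 0) ↔ j = 0 := by rw [Fin.ext_iff, Fin.val_zero]
    have h2 : ((j : ℕ) + 1 + 1 = m + 2) ↔ j = Fin.last m := by
      rw [Fin.ext_iff, Fin.val_last]
      omega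
    simp only [h1, h2]
    push_cast
    split_ifs <;> simp
  · intro k _ hk
    have : ¬ ((j.succ : ℕ) = k + 1) := by
      intro h
      apply hk
      ext
      simp at h ⊢
      omega
    simp only [crabbMatrix, Matrix.of_apply, if_neg this, zero_mul]
  · simp

theorem inner_crabbMatrix (m : ℕ) (x : EuclideanSpace ℂ (Fin (m + 2))) :
    inner ℂ x (Matrix.toEuclideanLin (crabbMatrix (m + 2)) x) =
      ∑ j : Fin (m + 1), (((if j = 0 then √2 else 1) * (if j = Fin.last m then √2 else 1) : ℝ) : ℂ)
        * x j.castSucc * (starRingEnd ℂ) (x j.succ) := by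
  rw [PiLp.inner_apply, Fin.sum_univ_succ]
  simp only [Matrix.toLpLin_apply, RCLike.inner_apply,
    crabbMatrix_mulVec_zero, crabbMatrix_mulVec_succ, zero_mul, zero_add]

/-- The squared weights count every coordinate twice. -/
theorem sum_sq_weights {m : ℕ} (a : Fin (m + 2) → ℝ) :
    ∑ j : Fin (m + 1), ((if j = 0 then √2 else 1) ^ 2 * a j.castSucc +
      (if j = Fin.last m then √2 else 1) ^ 2 * a j.succ) = 2 * ∑ i, a i := by
  -- Interior coordinates occur once as `castSucc` and once as `succ`; each end coordinate occurs
  -- only once, but with weight 2.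
  have e : ∀ j : Fin (m + 1), ((if j = 0 then √2 else 1) ^ 2 * a j.castSucc +
      (if j = Fin.last m then √2 else 1) ^ 2 * a j.succ) =
      (a j.castSucc + if j = 0 then a j.castSucc else 0) +
        (a j.succ + if j = Fin.last m then a j.succ else 0) := by
    intro j
    split_ifs <;> norm_num <;> ring
  simp only [e, Finset.sum_add_distrib, Finset.sum_ite_eq', Finset.mem_univ, if_true]
  have h1 := Fin.sum_univ_succ a
  have h2 := Fin.sum_univ_castSucc a
  simp only [Fin.castSucc_zero, Fin.succ_last]
  linarith

/-- AM-GM on each term, with one factor of the weight given to each coordinate; `sum_sq_weights`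
adds up the result. -/
theorem norm_inner_crabbMatrix_le (m : ℕ) (x : EuclideanSpace ℂ (Fin (m + 2))) :
    ‖inner ℂ x (Matrix.toEuclideanLin (crabbMatrix (m + 2)) x)‖ ≤ ‖x‖ ^ 2 := by
  rw [inner_crabbMatrix, EuclideanSpace.norm_sq_eq]
  have h := sum_sq_weights fun i => ‖x i‖ ^ 2
  refine (norm_sum_le _ _).trans ?_
  have : ∀ j : Fin (m + 1), ‖(((if j = 0 then √2 else 1) *
      (if j = Fin.last m then √2 else 1) : ℝ) : ℂ) * x j.castSucc * (starRingEnd ℂ) (x j.succ)‖ ≤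
      ((if j = 0 then √2 else 1) ^ 2 * ‖x j.castSucc‖ ^ 2 +
      (if j = Fin.last m then √2 else 1) ^ 2 * ‖x j.succ‖ ^ 2) / 2 := by
    intro j
    rw [norm_mul, norm_mul, RCLike.norm_conj, Complex.norm_real, Real.norm_of_nonneg (by positivity)]
    nlinarith [sq_nonneg ((if j = 0 then √2 else 1) * ‖x j.castSucc‖ -
      (if j = Fin.last m then √2 else 1) * ‖x j.succ‖)]
  refine (Finset.sum_le_sum fun j _ => this j).trans ?_
  rw [← Finset.sum_div, h]
  linarith

theorem mem_numericalRange_of_inner_eq {n : ℕ} (A : Matrix (Fin n) (Fin n) ℂ)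
    (x : EuclideanSpace ℂ (Fin n)) (hx : x ≠ 0) (w : ℂ)
    (h : inner ℂ x (Matrix.toEuclideanLin A x) = w * (‖x‖ ^ 2 : ℝ)) : w ∈ numericalRange A := by
  have hx' : (‖x‖ : ℂ) ≠ 0 := by simpa using hx
  refine ⟨((‖x‖⁻¹ : ℝ) : ℂ) • x, ?_, ?_⟩
  · rw [norm_smul]
    simp [hx]
  · rw [map_smul, inner_smul_left, inner_smul_right, h]
    simp only [Complex.conj_ofReal]
    push_cast
    field_simp

theorem closedBall_subset_numericalRange (m : ℕ) :
    Metric.closedBall (0 : ℂ) 1 ⊆ numericalRange (crabbMatrix (m + 2)) := by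
  intro w hw
  have hw1 : ‖w‖ ≤ 1 := by simpa using hw
  obtain ⟨u, hu, hwu⟩ : ∃ u : ℂ, ‖u‖ = 1 ∧ w = ‖w‖ * u := by
    by_cases h0 : w = 0
    · exact ⟨1, by simp, by simp [h0]⟩
    · have : (‖w‖ : ℂ) ≠ 0 := by simpa using h0
      exact ⟨w / ‖w‖, by simp [h0], by field_simp⟩
  -- With these moduli both weighted neighbours equal `√2`, the equality case of AM-GM. The vector
  -- `t_k (r ū)^k` has quotient `u p(r)/q(r)`, whose modulus runs from 0 at `r = 0` to 1 at `r = 1`.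
  let t : Fin (m + 2) → ℝ := fun i => if i = 0 then 1 else if i = Fin.last (m + 1) then 1 else √2
  have ht1 : ∀ j : Fin (m + 1), (if j = 0 then √2 else 1) * t j.castSucc = √2 := by
    intro j
    have : j.castSucc ≠ Fin.last (m + 1) := (Fin.castSucc_lt_last j).ne
    by_cases hj : j = 0
    · simp [t, hj]
    · simp [t, hj, this]
  have ht2 : ∀ j : Fin (m + 1), (if j = Fin.last m then √2 else 1) * t j.succ = √2 := by
    intro j
    have : j.succ ≠ 0 := Fin.succ_ne_zero j
    by_cases hj : j = Fin.last m
    · simp [t, hj]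
    · have h' : j.succ ≠ Fin.last (m + 1) := by rwa [← Fin.succ_last, Ne, Fin.succ_inj]
      simp [t, hj, this, h']
  let q : ℝ → ℝ := fun r => ∑ k, t k ^ 2 * (r ^ (k : ℕ)) ^ 2
  let p : ℝ → ℝ := fun r => ∑ j : Fin (m + 1), 2 * (r ^ (j : ℕ) * r ^ ((j : ℕ) + 1))
  have hq : ∀ r, 0 < q r := by
    intro r
    simp only [q]
    rw [Fin.sum_univ_succ]
    have : 0 ≤ ∑ i : Fin (m + 1), t i.succ ^ 2 * (r ^ (i.succ : ℕ)) ^ 2 :=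
      Finset.sum_nonneg fun _ _ => by positivity
    simp only [t, if_true, Fin.val_zero] at this ⊢
    simp only [pow_zero, one_pow, mul_one]
    linarith
  have hpq1 : p 1 = q 1 := by
    have h := sum_sq_weights fun i => t i ^ 2
    simp only [← mul_pow, ht1, ht2] at h
    simp only [p, q, one_pow, mul_one]
    rw [Real.sq_sqrt (by norm_num)] at h
    simp only [Finset.sum_const, Finset.card_univ, Fintype.card_fin, nsmul_eq_mul] at h ⊢
    linarith
  have hcont : ContinuousOn (fun r => p r / q r) (Set.Icc 0 1) := by
    refine ContinuousOn.div ?_ ?_ fun r _ => (hq r).ne'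
    · exact Continuous.continuousOn (by fun_prop)
    · exact Continuous.continuousOn (by fun_prop)
  obtain ⟨r, -, hr⟩ := intermediate_value_Icc zero_le_one hcont
    (show ‖w‖ ∈ Set.Icc (p 0 / q 0) (p 1 / q 1) by
      rw [hpq1, div_self (hq 1).ne']
      refine ⟨?_, hw1⟩
      have : p 0 = 0 := by simp [p]
      rw [this, zero_div]
      exact norm_nonneg w)
  have hr' : p r = ‖w‖ * q r := by
    have := (hq r).ne'
    simp only at hr
    rw [← hr]
    field_simp
  let x : EuclideanSpace ℂ (Fin (m + 2)) :=
    WithLp.toLp 2 fun k => (t k : ℂ) * (r * (starRingEnd ℂ) u) ^ (k : ℕ)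
  have hnorm : ‖x‖ ^ 2 = q r := by
    rw [EuclideanSpace.norm_sq_eq]
    refine Finset.sum_congr rfl fun k _ => ?_
    simp only [x, norm_mul, norm_pow, RCLike.norm_conj, hu, Complex.norm_real, mul_one, mul_pow,
      Real.norm_eq_abs, sq_abs, one_pow]
    rw [← abs_pow, sq_abs]
  refine mem_numericalRange_of_inner_eq _ x (fun h => ?_) w ?_
  · rw [h] at hnorm
    have := hq r
    simp at hnorm
    linarith
  · rw [hnorm, inner_crabbMatrix]
    have huu : u * (starRingEnd ℂ) u = 1 := by
      rw [Complex.mul_conj, Complex.normSq_eq_norm_sq, hu]; simp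
    have hterm : ∀ j : Fin (m + 1), (((if j = 0 then √2 else 1) *
        (if j = Fin.last m then √2 else 1) : ℝ) : ℂ) * x j.castSucc * (starRingEnd ℂ) (x j.succ) =
        ((2 * (r ^ (j : ℕ) * r ^ ((j : ℕ) + 1)) : ℝ) : ℂ) * u := by
      intro j
      have h2 : (((if j = 0 then √2 else 1) * t j.castSucc *
          ((if j = Fin.last m then √2 else 1) * t j.succ) : ℝ) : ℂ) = 2 := by
        rw [ht1, ht2, Real.mul_self_sqrt (by norm_num)]; norm_num
      have hu' : ((starRingEnd ℂ) u) ^ (j : ℕ) * u ^ ((j : ℕ) + 1) = u := by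
        rw [pow_succ, ← mul_assoc, ← mul_pow, mul_comm (starRingEnd ℂ u) u, huu, one_pow, one_mul]
      simp only [x, Fin.val_castSucc, Fin.val_succ, map_mul, map_pow, Complex.conj_conj,
        Complex.conj_ofReal]
      generalize (if j = 0 then √2 else 1) = α at h2 ⊢
      generalize (if j = Fin.last m then √2 else 1) = β at h2 ⊢
      push_cast at h2 ⊢
      rw [mul_pow, mul_pow, ← h2]
      linear_combination (α * t j.castSucc * (β * t j.succ)) * (r : ℂ) ^ (j : ℕ) *
          (r : ℂ) ^ ((j : ℕ) + 1) * hu'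
    simp only [hterm]
    rw [← Finset.sum_mul, ← Complex.ofReal_sum]
    change ((p r : ℝ) : ℂ) * u = _
    rw [hr']
    conv_rhs => rw [hwu]
    push_cast
    ring

theorem numericalRange_crabbMatrix (m : ℕ) :
    numericalRange (crabbMatrix (m + 2)) = Metric.closedBall (0 : ℂ) 1 := by
  refine Set.Subset.antisymm ?_ (closedBall_subset_numericalRange m)
  rintro z ⟨x, hx, rfl⟩
  have := norm_inner_crabbMatrix_le m x
  rw [hx, one_pow] at this
  simpa using this


/-! ### The matrix `f(C)` in terms of Taylor coefficients -/

/-- The diagonal of the matrix `D` in `C = D⁻¹ J D`. -/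
noncomputable def crabbDiag {m : ℕ} (i : Fin (m + 2)) : ℝ :=
  if i = 0 then √2 else if i = Fin.last (m + 1) then (√2)⁻¹ else 1

theorem crabbDiag_pos {m : ℕ} (i : Fin (m + 2)) : 0 < crabbDiag i := by
  unfold crabbDiag
  split_ifs <;> positivity

theorem crabbDiag_ne_zero {m : ℕ} (i : Fin (m + 2)) : (crabbDiag i : ℂ) ≠ 0 := by
  exact_mod_cast (crabbDiag_pos i).ne'

theorem crabbMatrix_eq (m : ℕ) (i j : Fin (m + 2)) : crabbMatrix (m + 2) i j =
    (crabbDiag i : ℂ)⁻¹ * (if (i : ℕ) = j + 1 then 1 else 0) * crabbDiag j := by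
  simp only [crabbMatrix, Matrix.of_apply]
  by_cases h : (i : ℕ) = j + 1
  · have hj : j ≠ Fin.last (m + 1) := by
      intro h'
      have := i.2
      simp [h'] at h
      omega
    have hi : i ≠ 0 := by
      rintro rfl
      simp at h
    have e1 : ((j : ℕ) = 0) ↔ j = 0 := by rw [Fin.ext_iff, Fin.val_zero]
    have e2 : ((i : ℕ) + 1 = m + 2) ↔ i = Fin.last (m + 1) := by
      rw [Fin.ext_iff, Fin.val_last]
      omega
    rw [if_pos h, if_pos h]
    simp only [crabbDiag, e1, e2, if_neg hj, if_neg hi]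
    split_ifs <;> push_cast <;> simp [mul_comm]
  · simp [h]

theorem crabbMatrix_pow_apply (m k : ℕ) (i j : Fin (m + 2)) : (crabbMatrix (m + 2) ^ k) i j =
    (crabbDiag i : ℂ)⁻¹ * (if (i : ℕ) = j + k then 1 else 0) * crabbDiag j := by
  induction k generalizing i j with
  | zero =>
    rw [pow_zero, Matrix.one_apply, add_zero]
    by_cases h : i = j
    · have := crabbDiag_ne_zero j
      simp [h, this]
    · simp [h, Fin.val_inj]
  | succ k ih =>
    rw [pow_succ, Matrix.mul_apply]
    simp only [ih, crabbMatrix_eq]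
    by_cases hj : (j : ℕ) + 1 < m + 2
    · rw [Finset.sum_eq_single ⟨j + 1, hj⟩]
      · have := crabbDiag_ne_zero (⟨j + 1, hj⟩ : Fin (m + 2))
        simp only [if_true]
        rw [show (j : ℕ) + 1 + k = j + (k + 1) by ring]
        field_simp
      · intro b _ hb
        have : ¬ (b : ℕ) = j + 1 := fun h => hb (Fin.ext h)
        simp [this]
      · simp
    · have h1 : ¬ (i : ℕ) = j + (k + 1) := by have := i.2; omega
      rw [if_neg h1]
      rw [Finset.sum_eq_zero]
      · simp
      · intro b _
        have : ¬ (b : ℕ) = j + 1 := by have := b.2; omega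
        simp [this]

theorem crabbMatrix_pow_eq_zero (m : ℕ) : crabbMatrix (m + 2) ^ (m + 2) = 0 := by
  ext i j
  rw [crabbMatrix_pow_apply, if_neg]
  · simp
  · have := i.2
    omega

theorem spectrum_eq_singleton_zero_of_pow_eq_zero {A : Type*} [Ring A] [Algebra ℂ A] [Nontrivial A]
    {a : A} {n : ℕ} (ha : a ^ n = 0) : spectrum ℂ a = {0} := by
  ext z
  rw [Set.mem_singleton_iff]
  constructor
  · intro hz
    have := spectrum.pow_mem_pow a n hz
    rw [ha, spectrum.zero_eq, Set.mem_singleton_iff] at this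
    exact eq_zero_of_pow_eq_zero this
  · rintro rfl
    rw [spectrum.zero_mem_iff]
    intro hu
    exact (hu.pow n).ne_zero ha

/-- The minimal polynomial divides `X ^ N`, so only derivatives at 0 of order below `N` can matter.
-/
theorem agreesOnSpectrum_of_pow_eq_zero {n : ℕ} {A : Matrix (Fin n) (Fin n) ℂ} {N : ℕ}
    (hA : A ^ N = 0) (f : ℂ → ℂ) (p : Polynomial ℂ)
    (h : ∀ k < N, (Polynomial.derivative^[k] p).eval 0 = iteratedDeriv k f 0) :
    AgreesOnSpectrum A f p := by
  classical
  have hdvd : minpoly ℂ A ∣ (Polynomial.X - Polynomial.C 0) ^ N := by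
    rw [minpoly.dvd_iff]
    simp [hA]
  have h0 : (Polynomial.X - Polynomial.C (0 : ℂ)) ^ N ≠ 0 :=
    pow_ne_zero _ (Polynomial.X_sub_C_ne_zero 0)
  intro μ k hk
  have h1 := hk.trans_le (Polynomial.rootMultiplicity_le_rootMultiplicity_of_dvd h0 hdvd μ)
  by_cases hμ : μ = 0
  · subst hμ
    rw [Polynomial.rootMultiplicity_X_sub_C_pow] at h1
    exact h k h1
  · rw [Polynomial.rootMultiplicity_eq_zero] at h1
    · omega
    · simp [hμ]

theorem eval_iterate_derivative_sum_taylorCoeff (f : ℂ → ℂ) (n k : ℕ) (hk : k < n) :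
    (Polynomial.derivative^[k] (∑ i ∈ Finset.range n,
      Polynomial.C (taylorCoeff f i) * Polynomial.X ^ i)).eval 0 = iteratedDeriv k f 0 := by
  rw [← Polynomial.coeff_zero_eq_eval_zero, Polynomial.coeff_iterate_derivative, zero_add,
    Nat.descFactorial_self, nsmul_eq_mul]
  simp only [Polynomial.finsetSum_coeff, Polynomial.coeff_C_mul_X_pow]
  rw [Finset.sum_ite_eq, if_pos (Finset.mem_range.2 hk), taylorCoeff]
  have : (k.factorial : ℂ) ≠ 0 := by exact_mod_cast k.factorial_ne_zero
  field_simp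

theorem matrixFun_crabbMatrix_apply (f : ℂ → ℂ) (m : ℕ) (i j : Fin (m + 2)) :
    matrixFun f (crabbMatrix (m + 2)) i j = (crabbDiag i : ℂ)⁻¹ *
      (if j ≤ i then taylorCoeff f (i - j : ℕ) else 0) * crabbDiag j := by
  rw [matrixFun_eq_aeval _ f _ (agreesOnSpectrum_of_pow_eq_zero (crabbMatrix_pow_eq_zero m) f _
    fun k hk => eval_iterate_derivative_sum_taylorCoeff f (m + 2) k hk)]
  simp only [map_sum, map_mul, Polynomial.aeval_C, map_pow, Polynomial.aeval_X,
    ← Algebra.smul_def]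
  rw [Matrix.sum_apply]
  simp only [Matrix.smul_apply, crabbMatrix_pow_apply, smul_eq_mul]
  by_cases hij : j ≤ i
  · have hij' : (j : ℕ) ≤ i := hij
    rw [Finset.sum_eq_single ((i : ℕ) - j)]
    · rw [if_pos (by omega), if_pos hij]
      ring
    · intro k _ hk
      rw [if_neg (by omega)]
      ring
    · intro h
      have := i.2
      exact absurd (Finset.mem_range.2 (by omega)) h
  · have hij' : ¬ (j : ℕ) ≤ i := hij
    rw [if_neg hij, Finset.sum_eq_zero]
    · ring
    · intro k _
      rw [if_neg (by omega)]
      ring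

theorem matrixFun_crabbMatrix_mulVec (f : ℂ → ℂ) (m : ℕ) (x : Fin (m + 2) → ℂ) (i : Fin (m + 2)) :
    (matrixFun f (crabbMatrix (m + 2))).mulVec x i = (crabbDiag i : ℂ)⁻¹ *
      ∑ j : Fin (m + 2), (if j ≤ i then taylorCoeff f (i - j : ℕ) else 0) * (crabbDiag j * x j) := by
  simp only [Matrix.mulVec, dotProduct, matrixFun_crabbMatrix_apply, Finset.mul_sum]
  exact Finset.sum_congr rfl fun j _ => by ring

/-! ### The norm bound 2 and its equality case -/

/-- The squares of the diagonal of `D` are 2 at index 0 and at most 1 elsewhere. The extra sum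
retains the slack needed in the equality case. -/
theorem sum_sq_norm_crabbDiag_mul_le {m : ℕ} (x : Fin (m + 2) → ℂ) :
    ∑ i, ‖(crabbDiag i : ℂ) * x i‖ ^ 2 + ∑ i, (if i = 0 then 0 else ‖x i‖ ^ 2) ≤
      2 * ∑ i, ‖x i‖ ^ 2 := by
  rw [← Finset.sum_add_distrib, Finset.mul_sum]
  refine Finset.sum_le_sum fun i _ => ?_
  rw [norm_mul, mul_pow, Complex.norm_real, Real.norm_eq_abs, sq_abs]
  have := sq_nonneg ‖x i‖
  unfold crabbDiag
  split_ifs <;> norm_num <;> linarith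

theorem sum_sq_norm_crabbDiag_inv_mul_le {m : ℕ} (z : Fin (m + 2) → ℂ) :
    ∑ i, ‖(crabbDiag i : ℂ)⁻¹ * z i‖ ^ 2 +
      ∑ i, (if i = Fin.last (m + 1) then 0 else ‖z i‖ ^ 2) ≤ 2 * ∑ i, ‖z i‖ ^ 2 := by
  rw [← Finset.sum_add_distrib, Finset.mul_sum]
  refine Finset.sum_le_sum fun i _ => ?_
  rw [norm_mul, mul_pow, norm_inv, Complex.norm_real, Real.norm_eq_abs, inv_pow, sq_abs]
  have := sq_nonneg ‖z i‖
  unfold crabbDiag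
  split_ifs with h1 h2 <;> norm_num <;> linarith

theorem norm_sq_toEuclideanCLM {n : ℕ} (A : Matrix (Fin n) (Fin n) ℂ)
    (x : EuclideanSpace ℂ (Fin n)) :
    ‖Matrix.toEuclideanCLM (n := Fin n) (𝕜 := ℂ) A x‖ ^ 2 = ∑ i, ‖A.mulVec x i‖ ^ 2 := by
  rw [EuclideanSpace.norm_sq_eq]
  simp only [Matrix.ofLp_toEuclideanCLM]

/-- The bound `‖f(C)‖ ≤ 2`, with the defect in terms of the vector and its image. -/
theorem norm_sq_matrixFun_crabbMatrix_add_le {f : ℂ → ℂ}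
    (hf : f ∈ hInftyUnitBall (Metric.ball 0 1)) {m : ℕ} (x : EuclideanSpace ℂ (Fin (m + 2))) :
    ‖Matrix.toEuclideanCLM (n := Fin (m + 2)) (𝕜 := ℂ) (matrixFun f (crabbMatrix (m + 2))) x‖ ^ 2 +
      ∑ i : Fin (m + 2), (if i = Fin.last (m + 1) then 0 else ‖∑ j : Fin (m + 2),
        (if j ≤ i then taylorCoeff f (i - j : ℕ) else 0) * (crabbDiag j * x j)‖ ^ 2) +
      2 * ∑ i, (if i = 0 then 0 else ‖x i‖ ^ 2) ≤ 4 * ‖x‖ ^ 2 := by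
  rw [norm_sq_toEuclideanCLM, EuclideanSpace.norm_sq_eq]
  simp only [matrixFun_crabbMatrix_mulVec]
  -- With `z = TDx`, the chain is `‖D⁻¹z‖² ≤ 2‖z‖² ≤ 2‖Dx‖² ≤ 4‖x‖²`, keeping the slack of the outer
  -- two steps.
  have h1 := sum_sq_norm_crabbDiag_mul_le x
  have h2 := sum_sq_norm_toeplitz_le hf fun j => (crabbDiag j : ℂ) * x j
  have h3 := sum_sq_norm_crabbDiag_inv_mul_le fun i : Fin (m + 2) => ∑ j : Fin (m + 2),
    (if j ≤ i then taylorCoeff f (i - j : ℕ) else 0) * (crabbDiag j * x j)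
  linarith

theorem norm_matrixFun_crabbMatrix_le_two {f : ℂ → ℂ}
    (hf : f ∈ hInftyUnitBall (Metric.ball 0 1)) (m : ℕ) :
    ‖matrixFun f (crabbMatrix (m + 2))‖ ≤ 2 := by
  rw [← Matrix.l2_opNorm_toEuclideanCLM]
  refine ContinuousLinearMap.opNorm_le_bound _ (by norm_num) fun x => ?_
  have h := norm_sq_matrixFun_crabbMatrix_add_le hf x
  refine abs_le_of_sq_le_sq' ?_ (by positivity) |>.2
  have h1 : 0 ≤ ∑ i : Fin (m + 2), (if i = Fin.last (m + 1) then 0 else ‖∑ j : Fin (m + 2),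
        (if j ≤ i then taylorCoeff f (i - j : ℕ) else 0) * (crabbDiag j * x j)‖ ^ 2) :=
    Finset.sum_nonneg fun i _ => by split_ifs <;> positivity
  have h2 : 0 ≤ ∑ i, (if i = 0 then 0 else ‖x i‖ ^ 2) :=
    Finset.sum_nonneg fun i _ => by split_ifs <;> positivity
  rw [mul_pow]
  linarith

/-- Compactness of the unit sphere; the equality case needs a vector at which the norm is attained.
-/
theorem exists_norm_toEuclideanCLM_eq {n : ℕ} [NeZero n] (A : Matrix (Fin n) (Fin n) ℂ) :
    ∃ x : EuclideanSpace ℂ (Fin n), ‖x‖ = 1 ∧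
      ‖A‖ ≤ ‖Matrix.toEuclideanCLM (n := Fin n) (𝕜 := ℂ) A x‖ := by
  obtain ⟨x, hx, hmax⟩ := (isCompact_sphere (0 : EuclideanSpace ℂ (Fin n)) 1).exists_isMaxOn
    (NormedSpace.sphere_nonempty.2 zero_le_one)
    (f := fun x => ‖Matrix.toEuclideanCLM (n := Fin n) (𝕜 := ℂ) A x‖)
    (by fun_prop)
  refine ⟨x, by simpa using hx, ?_⟩
  rw [← Matrix.l2_opNorm_toEuclideanCLM]
  exact ContinuousLinearMap.opNorm_le_of_unit_norm (norm_nonneg _) fun y hy =>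
    hmax (by simpa using hy)

/-- The bottom left entry of `f(C)` is `√2 · a_{m+1} · √2`. -/
theorem two_mul_norm_taylorCoeff_le (f : ℂ → ℂ) (m : ℕ) :
    2 * ‖taylorCoeff f (m + 1)‖ ≤ ‖matrixFun f (crabbMatrix (m + 2))‖ := by
  have h := (Matrix.toEuclideanCLM (n := Fin (m + 2)) (𝕜 := ℂ)
    (matrixFun f (crabbMatrix (m + 2)))).le_opNorm (EuclideanSpace.single 0 1)
  rw [Matrix.l2_opNorm_toEuclideanCLM, PiLp.norm_single, norm_one, mul_one] at h
  refine le_trans ?_ h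
  refine le_trans (le_of_eq ?_) (PiLp.norm_apply_le _ (Fin.last (m + 1)))
  rw [Matrix.ofLp_toEuclideanCLM]
  have : ((√2 : ℝ) : ℂ) * (√2 : ℝ) = 2 := by
    rw [← Complex.ofReal_mul, Real.mul_self_sqrt (by norm_num)]; norm_num
  simp only [PiLp.ofLp_single, Matrix.mulVec_single_one, Matrix.col_apply,
    matrixFun_crabbMatrix_apply]
  have h1 : crabbDiag (Fin.last (m + 1)) = (√2)⁻¹ := by
    simp [crabbDiag]
  rw [h1, if_pos (Fin.zero_le _)]
  simp only [crabbDiag, if_true, Fin.val_last, Fin.val_zero, Nat.sub_zero]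
  rw [mul_right_comm, norm_mul]
  congr 1
  push_cast
  rw [inv_inv, this]
  simp

/-- The Taylor coefficients of an extremal function. -/
theorem taylorCoeff_of_two_le_norm {f : ℂ → ℂ} (hf : f ∈ hInftyUnitBall (Metric.ball 0 1)) {m : ℕ}
    (h : 2 ≤ ‖matrixFun f (crabbMatrix (m + 2))‖) :
    ‖taylorCoeff f (m + 1)‖ = 1 ∧ ∀ k ≠ m + 1, taylorCoeff f k = 0 := by
  obtain ⟨x, hx, hmax⟩ := exists_norm_toEuclideanCLM_eq (matrixFun f (crabbMatrix (m + 2)))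
  have hmain := norm_sq_matrixFun_crabbMatrix_add_le hf x
  have hn1 : ∀ i : Fin (m + 2), 0 ≤ (if i = Fin.last (m + 1) then 0 else ‖∑ j : Fin (m + 2),
      (if j ≤ i then taylorCoeff f (i - j : ℕ) else 0) * (crabbDiag j * x j)‖ ^ 2) :=
    fun i => by split_ifs <;> positivity
  have hn2 : ∀ i : Fin (m + 2), 0 ≤ (if i = 0 then 0 else ‖x i‖ ^ 2) :=
    fun i => by split_ifs <;> positivity
  have hs1 := Finset.sum_nonneg fun i (_ : i ∈ Finset.univ) => hn1 i
  have hs2 := Finset.sum_nonneg fun i (_ : i ∈ Finset.univ) => hn2 i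
  have h4 : 4 ≤ ‖Matrix.toEuclideanCLM (n := Fin (m + 2)) (𝕜 := ℂ)
      (matrixFun f (crabbMatrix (m + 2))) x‖ ^ 2 := by nlinarith
  rw [hx] at hmain
  -- At a maximizing vector there is no room for slack, so every defect term vanishes.
  have hz1 := (Finset.sum_eq_zero_iff_of_nonneg fun i _ => hn1 i).1 (le_antisymm (by linarith) hs1)
  have hz2 := (Finset.sum_eq_zero_iff_of_nonneg fun i _ => hn2 i).1 (le_antisymm (by linarith) hs2)
  have hx0 : ∀ i : Fin (m + 2), i ≠ 0 → x i = 0 := by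
    intro i hi
    simpa [hi] using hz2 i (Finset.mem_univ i)
  have hx1 : x 0 ≠ 0 := by
    intro h0
    have : x = 0 := by
      ext i
      by_cases hi : i = 0
      · rw [hi, h0]; rfl
      · rw [hx0 i hi]; rfl
    simp [this] at hx
  have hT : ∀ i : Fin (m + 2), ∑ j : Fin (m + 2),
      (if j ≤ i then taylorCoeff f (i - j : ℕ) else 0) * (crabbDiag j * x j) =
      taylorCoeff f i * (crabbDiag (0 : Fin (m + 2)) * x 0) := by
    intro i
    rw [Finset.sum_eq_single 0]
    · simp
    · intro j _ hj
      rw [hx0 j hj]; ring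
    · simp
  have hlow : ∀ k < m + 1, taylorCoeff f k = 0 := by
    intro k hk
    have := hz1 ⟨k, by omega⟩ (Finset.mem_univ _)
    rw [if_neg (by rw [Fin.ext_iff, Fin.val_last]; exact hk.ne), hT] at this
    have h0 := (crabbDiag_pos (0 : Fin (m + 2))).ne'
    simpa [hx1, h0] using this
  have hge : 1 ≤ ‖taylorCoeff f (m + 1)‖ := by
    have hle : ‖Matrix.toEuclideanCLM (n := Fin (m + 2)) (𝕜 := ℂ)
        (matrixFun f (crabbMatrix (m + 2))) x‖ ^ 2 = 4 * ‖taylorCoeff f (m + 1)‖ ^ 2 := by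
      rw [norm_sq_toEuclideanCLM]
      simp only [matrixFun_crabbMatrix_mulVec, hT]
      rw [EuclideanSpace.norm_eq, Real.sqrt_eq_one, Finset.sum_eq_single 0] at hx
      · rw [Finset.sum_eq_single (Fin.last (m + 1))]
        · simp only [norm_mul, mul_pow, hx, norm_inv, Complex.norm_real, Real.norm_eq_abs,
            inv_pow, sq_abs, Fin.val_last]
          have hl : crabbDiag (Fin.last (m + 1)) = (√2)⁻¹ := by simp [crabbDiag]
          rw [hl]
          simp [crabbDiag]
          ring
        · intro i _ hi
          rw [hlow i (lt_of_le_of_ne (Nat.lt_succ_iff.1 i.2) fun h => hi (Fin.ext h))]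
          simp
        · simp
      · intro i _ hi
        rw [hx0 i hi]; simp
      · simp
    rw [hle] at h4
    nlinarith [norm_nonneg (taylorCoeff f (m + 1))]
  have hB := sum_sq_norm_taylorCoeff_le_one hf
  have hk : ∀ k ≠ m + 1, taylorCoeff f k = 0 := by
    intro k hk
    -- Coefficient `m + 1` already exhausts Bessel's bound, leaving nothing for `k`.
    have h1 : ∑ i ∈ {k, m + 1}, ‖taylorCoeff f i‖ ^ 2 ≤ 1 := by
      refine le_trans (Finset.sum_le_sum_of_subset_of_nonneg ?_ fun _ _ _ => by positivity)
        (hB (k + m + 2))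
      intro i hi
      simp only [Finset.mem_insert, Finset.mem_singleton] at hi
      rw [Finset.mem_range]
      omega
    rw [Finset.sum_pair hk] at h1
    have : ‖taylorCoeff f k‖ ^ 2 ≤ 0 := by nlinarith
    simpa using le_antisymm this (by positivity)
  refine ⟨le_antisymm ?_ hge, hk⟩
  have h1 := (Finset.single_le_sum (f := fun k => ‖taylorCoeff f k‖ ^ 2)
    (fun _ _ => by positivity) (Finset.mem_range.2 (Nat.lt_succ_self (m + 1)))).trans (hB (m + 2))
  nlinarith [norm_nonneg (taylorCoeff f (m + 1))]

theorem taylorCoeff_monomial {f : ℂ → ℂ} {γ : ℂ} {N : ℕ}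
    (h : ∀ z ∈ Metric.ball (0 : ℂ) 1, f z = γ * z ^ N) : taylorCoeff f N = γ := by
  have he : f =ᶠ[nhds 0] fun z => γ * z ^ N :=
    Filter.eventually_of_mem (Metric.ball_mem_nhds 0 one_pos) h
  rw [taylorCoeff, he.iteratedDeriv_eq, iteratedDeriv_const_mul_field, iteratedDeriv_pow]
  have : (N.factorial : ℂ) ≠ 0 := by exact_mod_cast N.factorial_ne_zero
  simp [Nat.descFactorial_self, this]

theorem monomial_mem_hInftyUnitBall {f : ℂ → ℂ} {γ : ℂ} (hγ : ‖γ‖ = 1) {N : ℕ}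
    (h : ∀ z ∈ Metric.ball (0 : ℂ) 1, f z = γ * z ^ N) :
    f ∈ hInftyUnitBall (Metric.ball 0 1) := by
  refine ⟨DifferentiableOn.congr (f := fun z => γ * z ^ N) (by fun_prop) h, fun z hz => ?_⟩
  rw [h z hz, norm_mul, hγ, one_mul, norm_pow]
  exact pow_le_one₀ (norm_nonneg z) (by simpa using (Metric.mem_ball.1 hz).le)

theorem isExtremal_crabbMatrix_iff (m : ℕ) (f : ℂ → ℂ) :
    IsExtremal (crabbMatrix (m + 2)) (Metric.ball (0 : ℂ) 1) f ↔
      ∃ γ : ℂ, ‖γ‖ = 1 ∧ ∀ z ∈ Metric.ball (0 : ℂ) 1, f z = γ * z ^ (m + 1) := by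
  have hlow : ∀ g : ℂ → ℂ, ∀ γ : ℂ, ‖γ‖ = 1 →
      (∀ z ∈ Metric.ball (0 : ℂ) 1, g z = γ * z ^ (m + 1)) →
      2 ≤ ‖matrixFun g (crabbMatrix (m + 2))‖ := by
    intro g γ hγ hg
    have := two_mul_norm_taylorCoeff_le g m
    rwa [taylorCoeff_monomial hg, hγ, mul_one] at this
  constructor
  · rintro ⟨hf, hext⟩
    have hg : ∀ z ∈ Metric.ball (0 : ℂ) 1, (fun z : ℂ => 1 * z ^ (m + 1)) z = 1 * z ^ (m + 1) :=
      fun _ _ => rfl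
    obtain ⟨h1, h0⟩ := taylorCoeff_of_two_le_norm hf ((hlow _ 1 norm_one hg).trans
      (hext _ (monomial_mem_hInftyUnitBall norm_one hg)))
    refine ⟨taylorCoeff f (m + 1), h1, fun z hz => ?_⟩
    refine (hasSum_taylorCoeff hf.1 hz).unique (hasSum_single (m + 1) fun k hk => ?_)
    rw [h0 k hk, zero_mul]
  · rintro ⟨γ, hγ, h⟩
    exact ⟨monomial_mem_hInftyUnitBall hγ h, fun g hg =>
      (norm_matrixFun_crabbMatrix_le_two hg m).trans (hlow f γ hγ h)⟩

theorem mainTheorem4 (n : ℕ) (hn : 2 ≤ n) :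
    spectrum ℂ (crabbMatrix n) = {0} ∧
    numericalRange (crabbMatrix n) = Metric.closedBall (0 : ℂ) 1 ∧
    ∀ f : ℂ → ℂ, IsExtremal (crabbMatrix n) (Metric.ball (0 : ℂ) 1) f ↔
      ∃ γ : ℂ, ‖γ‖ = 1 ∧ ∀ z ∈ Metric.ball (0 : ℂ) 1, f z = γ * z ^ (n - 1) := by
  obtain ⟨m, rfl⟩ := Nat.exists_eq_add_of_le' hn
  exact ⟨spectrum_eq_singleton_zero_of_pow_eq_zero (crabbMatrix_pow_eq_zero m),
    numericalRange_crabbMatrix m, isExtremal_crabbMatrix_iff m⟩
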